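/- Let $N=\{1,\dots,n\}$ be a finite set of agents and $G$ a finite set of goods. Each agent $i$ has a matroid rank (binary submodular) valuation $v_i$ on subsets of $G$: $v_i(\emptyset)=0$, every marginal gain $\Delta_i(S,g)=v_i(S\cup\{g\})-v_i(S)$ lies in $\{0,1\}$, and $\Delta_i(S,g)\ge\Delta_i(T,g)$ whenever $S\subseteq T\subseteq G$, $g\in G$. An allocation $X=(X_0,X_1,\dots,X_n)$ is a partition of $G$ into possibly empty parts, where $X_i$ is the bundle of agent $i$ and $X_0$ consists of the unallocated goods; its utility vector is $\vec u^X=(v_1(X_1),\dots,v_n(X_n))$. Put $v_0(S)=|S|$. A justice criterion $\Psi$ is a total preorder $\succeq_\Psi$ on $\mathbb Z_{\ge 0}^n$; write $x\succ_\Psi y$ if $x\succeq_\Psi y$ and not $y\succeq_\Psi x$, and $x=_\Psi y$ if $x\succeq_\Psi y$ and $y\succeq_\Psi x$. An allocation $X$ is $\Psi$-maximizing if there is no allocation $Y$ with $\vec u^Y\succ_\Psi\vec u^X$. Vectors in $\mathbb R^b$ are compared lexicographically, and $x$ lexicographically dominates $y$ if for some $k$ we have $x_k>y_k$ and $x_j=y_j$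 for all $j<k$. Assume: - (C1) For all $x,y\in\mathbb Z_{\ge0}^n$ with $x_h\ge y_h$ for every $h\in N$: $x\succeq_\Psi y$, and $x=_\Psi y$ if and only if $x=y$. - (C2) $\phi:\mathbb Z_{\ge0}^n\times N\to\mathbb R^b$ is a gain function for $\Psi$, that is (with $e_i$ the $i$-th unit vector): - (G1) for all $x\in\mathbb Z_{\ge0}^n$ and $i,j\in N$ with $\phi(x,i)\ge\phi(x,j)$: $x+e_i\succeq_\Psi x+e_j$, and $x+e_i=_\Psi x+e_j$ if and only if $\phi(x,i)=\phi(x,j)$; - (G2) for all $x,y\in\mathbb Z_{\ge0}^n$ and $i\in N$ with $x_i\le y_i$: $\phi(x,i)\ge\phi(y,i)$, with equality if $x_i=y_i$. General Yankee Swap with input $\phi$ starts with $X_0=G$, $X_i=\emptyset$ for all $i\in N$, and $U=N$. While $U\ne\emptyset$, it takes the agent $i$ of least index among those maximizing $\phi(\vec u^X,\cdot)$ over $U$, and looks for a shortest path $P=(p_1,\dots,p_t)$ (any shortest path may be used) from $F_i(X)=\{g\in G:\Delta_i(X_i,g)=1\}$ to $X_0$ in the exchange graph of $X$. This is the directed graph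 on $G$ with an edge from $g\in X_k$ ($k\in N\cup\{0\}$) to $g'$ whenever $v_k((X_k\setminus\{g\})\cup\{g'\})=v_k(X_k)$. If such a path exists, every bundle $X_k$ with $k\in N\cup\{0\}$ is replaced by $(X_k\setminus\{p_t\})\oplus\{p_j,p_{j+1}:1\le j<t,\ p_j\in X_k\}$, where $\oplus$ is symmetric difference, and $p_1$ is added to the bundle of $i$; otherwise $i$ is removed from $U$. When $U=\emptyset$ it returns $X$. **Theorem.** Under these assumptions General Yankee Swap always terminates, and every allocation $X$ that it can output is $\Psi$-maximizing. Moreover, $\vec u^X$ lexicographically dominates $\vec u^Y$ for every $\Psi$-maximizing allocation $Y$ with $\vec u^Y\ne\vec u^X$. -/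

import Mathlib

namespace YankeeSwap

section Basic

variable {n : ℕ} {G : Type*}

/-- The marginal gain `Δ(S, g) = v(S + g) - v(S)`. -/
def marginal [DecidableEq G] (v : Finset G → ℕ) (S : Finset G) (g : G) : ℤ :=
  (v (insert g S) : ℤ) - (v S : ℤ)

/-- Matroid rank (binary submodular) valuations. Such a valuation takes only non-negative integer
values, so its codomain is `ℕ`. -/
structure IsMatroidRank [DecidableEq G] (v : Finset G → ℕ) : Prop where
  empty : v ∅ = 0
  binary : ∀ (S : Finset G) (g : G), marginal v S g = 0 ∨ marginal v S g = 1
  submodular : ∀ (S T : Finset G) (g : G), S ⊆ T → marginal v T g ≤ marginal v S g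

/-- An allocation is a partition `(X₀, X₁, …, Xₙ)` of the goods, given by the map that sends a good
to the index of the part containing it: `some i` for agent `i`, and `none` for the index `0` of
the unallocated goods. -/
abbrev Allocation (n : ℕ) (G : Type*) : Type _ := G → Option (Fin n)

/-- The part of the partition with a given index. -/
def bundle [Fintype G] (X : Allocation n G) (k : Option (Fin n)) : Finset G :=
  Finset.univ.filter (fun g => X g = k)

/-- The utility vector `(v₁(X₁), …, vₙ(Xₙ))`. -/
def utility [Fintype G] (v : Fin n → Finset G → ℕ) (X : Allocation n G) : Fin n → ℕ :=
  fun i => v i (bundle X (some i))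

/-- `x` lexicographically dominates `y`. -/
def LexDominates {c : ℕ} {α : Type*} [LT α] (x y : Fin c → α) : Prop :=
  ∃ k : Fin c, (∀ j : Fin c, j < k → x j = y j) ∧ y k < x k

/-- The strict order on Mathlib's type synonym `Lex` is lexicographic domination. -/
theorem lexDominates_iff {c : ℕ} {α : Type*} [LT α] (x y : Fin c → α) :
    LexDominates x y ↔ toLex y < toLex x := by
  constructor
  · rintro ⟨k, h, hk⟩
    exact ⟨k, fun j hj => (h j hj).symm, hk⟩
  · rintro ⟨k, h, hk⟩
    exact ⟨k, fun j hj => (h j hj).symm, hk⟩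

end Basic

section Criterion

/-- A justice criterion: a total preorder `⪰` on the vectors of non-negative integers
(distinct vectors may be equally good). -/
structure JusticeCriterion (n : ℕ) where
  ge : (Fin n → ℕ) → (Fin n → ℕ) → Prop
  total : ∀ x y, ge x y ∨ ge y x
  trans : ∀ x y z, ge x y → ge y z → ge x z

variable {n : ℕ} (Ψ : JusticeCriterion n)

/-- `x ≻ y`: `x` is strictly better than `y`. -/
def JusticeCriterion.gt (x y : Fin n → ℕ) : Prop := Ψ.ge x y ∧ ¬ Ψ.ge y x

/-- `x` and `y` are equally good. -/
def JusticeCriterion.equiv (x y : Fin n → ℕ) : Prop := Ψ.ge x y ∧ Ψ.ge y x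

/-- (C1): if `x ≥ y` coordinatewise then `x ⪰ y`, with equality if and only if `x = y`. -/
def ParetoDominance : Prop :=
  ∀ x y : Fin n → ℕ, (∀ h, y h ≤ x h) → Ψ.ge x y ∧ (Ψ.equiv x y ↔ x = y)

/-- (C2): `φ` is a gain function for the criterion. Its values are vectors in `ℝᵇ`, compared
lexicographically. -/
structure IsGainFunction {b : ℕ} (φ : (Fin n → ℕ) → Fin n → Lex (Fin b → ℝ)) : Prop where
  G1 : ∀ (x : Fin n → ℕ) (i j : Fin n), φ x i ≥ φ x j →
    Ψ.ge (x + Pi.single i 1) (x + Pi.single j 1) ∧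
      (Ψ.equiv (x + Pi.single i 1) (x + Pi.single j 1) ↔ φ x i = φ x j)
  G2 : ∀ (x y : Fin n → ℕ) (i : Fin n), x i ≤ y i →
    φ x i ≥ φ y i ∧ (x i = y i → φ x i = φ y i)

/-- An allocation is `Ψ`-maximizing if no allocation has a strictly better utility vector. -/
def IsMaximizing {G : Type*} [Fintype G] (v : Fin n → Finset G → ℕ) (X : Allocation n G) : Prop :=
  ¬ ∃ Y : Allocation n G, Ψ.gt (utility v Y) (utility v X)

end Criterion

section Algorithm

variable {n : ℕ} {G : Type*} [Fintype G] [DecidableEq G]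

/-- The valuations, with the additional valuation `v₀(S) = |S|` of the index `none`. -/
def extVal (v : Fin n → Finset G → ℕ) : Option (Fin n) → Finset G → ℕ
  | none => Finset.card
  | some i => v i

/-- The edges of the exchange graph: `g → g'` if the owner `k` of `g` (which may be `none`)
can replace `g` by `g'` without changing the value of its bundle. -/
def ExchangeEdge (v : Fin n → Finset G → ℕ) (X : Allocation n G) (g g' : G) : Prop :=
  ∃ k : Option (Fin n), g ∈ bundle X k ∧
    extVal v k (insert g' ((bundle X k).erase g)) = extVal v k (bundle X k)

/-- `Fᵢ(X)`: the goods with marginal gain `1` for agent `i`. -/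
def desired (v : Fin n → Finset G → ℕ) (X : Allocation n G) (i : Fin n) : Finset G :=
  Finset.univ.filter (fun g => marginal (v i) (bundle X (some i)) g = 1)

/-- `P` is a path in the exchange graph, with `t + 1` vertices, from `Fᵢ(X)` to the unallocated
goods `X₀`. -/
def IsTransferPath (v : Fin n → Finset G → ℕ) (X : Allocation n G) (i : Fin n)
    {t : ℕ} (P : Fin (t + 1) → G) : Prop :=
  P 0 ∈ desired v X i ∧ P (Fin.last t) ∈ bundle X none ∧
    ∀ j : Fin t, ExchangeEdge v X (P j.castSucc) (P j.succ)

/-- `P` is a shortest such path. -/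
def IsShortestTransferPath (v : Fin n → Finset G → ℕ) (X : Allocation n G) (i : Fin n)
    {t : ℕ} (P : Fin (t + 1) → G) : Prop :=
  IsTransferPath v X i P ∧
    ∀ (s : ℕ) (Q : Fin (s + 1) → G), IsTransferPath v X i Q → t ≤ s

/-- Path augmentation of the bundle `X_k` along a path `P = (g₁, …, g_t)`, i.e.
`(X_k - g_t) ⊕ {g_j, g_{j+1} : g_j ∈ X_k}`, where `j` ranges over the edges of the path. -/
def augment (X : Allocation n G) (k : Option (Fin n)) {t : ℕ} (P : Fin (t + 1) → G) : Finset G :=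
  symmDiff ((bundle X k).erase (P (Fin.last t)))
    ((Finset.univ.filter (fun j : Fin t => P j.castSucc ∈ bundle X k)).biUnion
      (fun j => {P j.castSucc, P j.succ}))

/-- `Y` results from `X` by augmenting all bundles along `P` and giving the first good of `P`
to agent `i`. -/
def IsTransfer (X : Allocation n G) (i : Fin n) {t : ℕ} (P : Fin (t + 1) → G)
    (Y : Allocation n G) : Prop :=
  bundle Y (some i) = insert (P 0) (augment X (some i) P) ∧
    ∀ k : Option (Fin n), k ≠ some i → bundle Y k = augment X k P

/-- The state of the algorithm: the current allocation `X`, and the set `U` of the agents that are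
still playing. -/
structure State (n : ℕ) (G : Type*) where
  X : Allocation n G
  U : Finset (Fin n)

/-- Initially all goods are unallocated and all agents are playing. -/
def State.init (n : ℕ) (G : Type*) : State n G := ⟨fun _ => none, Finset.univ⟩

/-- Agent `i` is the agent of least index among those in `U` that maximize `φ` at the vector `x`. -/
def IsChosen {β : Type*} [LE β] (φ : (Fin n → ℕ) → Fin n → β) (x : Fin n → ℕ)
    (U : Finset (Fin n)) (i : Fin n) : Prop :=
  (i ∈ U ∧ ∀ k ∈ U, φ x k ≤ φ x i) ∧
    ∀ j : Fin n, (j ∈ U ∧ ∀ k ∈ U, φ x k ≤ φ x j) → i ≤ j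

/-- One iteration of the main loop of General Yankee Swap. Any shortest path may be used. -/
inductive Step {β : Type*} [LE β] (v : Fin n → Finset G → ℕ) (φ : (Fin n → ℕ) → Fin n → β) :
    State n G → State n G → Prop
  | transfer (X Y : Allocation n G) (U : Finset (Fin n)) (i : Fin n) (t : ℕ)
      (P : Fin (t + 1) → G) (chosen : IsChosen φ (utility v X) U i)
      (shortest : IsShortestTransferPath v X i P) (result : IsTransfer X i P Y) :
      Step v φ ⟨X, U⟩ ⟨Y, U⟩
  | remove (X : Allocation n G) (U : Finset (Fin n)) (i : Fin n)
      (chosen : IsChosen φ (utility v X) U i)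
      (noPath : ¬ ∃ (t : ℕ) (P : Fin (t + 1) → G), IsTransferPath v X i P) :
      Step v φ ⟨X, U⟩ ⟨X, U.erase i⟩

/-- The states that General Yankee Swap can reach. -/
def Reachable {β : Type*} [LE β] (v : Fin n → Finset G → ℕ) (φ : (Fin n → ℕ) → Fin n → β)
    (s : State n G) : Prop :=
  Relation.ReflTransGen (Step v φ) (State.init n G) s

/-- `X` is returned by some run of General Yankee Swap. -/
def IsOutput {β : Type*} [LE β] (v : Fin n → Finset G → ℕ) (φ : (Fin n → ℕ) → Fin n → β)
    (X : Allocation n G) : Prop :=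
  Reachable v φ ⟨X, ∅⟩

/-- General Yankee Swap always terminates properly: the loop body can be executed whenever an agent
is still playing, and no run goes on forever. -/
def Terminates {β : Type*} [LE β] (v : Fin n → Finset G → ℕ) (φ : (Fin n → ℕ) → Fin n → β) :
    Prop :=
  (∀ s : State n G, Reachable v φ s → s.U ≠ ∅ → ∃ s', Step v φ s s') ∧
    ¬ ∃ r : ℕ → State n G, r 0 = State.init n G ∧ ∀ k, Step v φ (r k) (r (k + 1))

end Algorithm

end YankeeSwap

/-! Among the `Ψ`-maximizing allocations, choose `Z` with lexicographically largest utility vector.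
In every reachable state the current vector is coordinatewise at most that of `Z`, and equal to it
at the agents already removed (`Reachable.utility_le`). When nobody plays, the two vectors coincide,
which gives both optimality claims.

Two facts about matroids carry this invariant. Augmenting along a shortest path raises the utility
of the starting agent by one and changes no other (`IsTransfer.clean_and_utility`): having no
shortcuts makes the exchanges in each bundle triangular, so that they can be made one at a time
(`IsMatroidRank.multi_exchange`). If there is no path, the goods reachable from `Fᵢ(X)` certify that
some set of agents containing `i` has maximal total utility (`exists_tight_of_noPath`); hence a
removed agent has already reached its value in `Z`. Together the two facts yield an exchange
property of utility vectors (`exists_exchange`).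

Suppose now that a transfer took `i` above `Z`. The exchange property moves one unit in `Z` from
some `j`, still playing and below its value in `Z`, to `i`. As `i` was chosen before `j`, the gain
function makes the new vector at least as good, so by maximality of `Z` it is equally good and the
gains tie. The tie-break gives `i < j`, so the new vector lexicographically beats `Z`, a
contradiction.

Termination holds since each iteration raises the bounded total utility or removes an agent. -/

namespace YankeeSwap

/-! ### Rank functions and simultaneous exchange -/

section MatroidRank

variable {G : Type*} [DecidableEq G] {v : Finset G → ℕ}

theorem IsMatroidRank.insert_eq_or (hv : IsMatroidRank v) (S : Finset G) (g : G) :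
    v (insert g S) = v S ∨ v (insert g S) = v S + 1 := by
  have := hv.binary S g
  unfold marginal at this
  omega

theorem IsMatroidRank.insert_eq_of_subset (hv : IsMatroidRank v) {S T : Finset G} (h : S ⊆ T)
    {g : G} (hg : v (insert g S) = v S) : v (insert g T) = v T := by
  have h1 := hv.submodular S T g h
  have h2 := hv.insert_eq_or T g
  unfold marginal at h1
  omega

theorem IsMatroidRank.mono (hv : IsMatroidRank v) {S T : Finset G} (h : S ⊆ T) : v S ≤ v T := by
  have key : ∀ A : Finset G, v S ≤ v (A ∪ S) := by
    intro A
    induction A using Finset.induction_on with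
    | empty => simp
    | insert a A _ ih =>
      rw [Finset.insert_union]
      rcases hv.insert_eq_or (A ∪ S) a with h | h <;> omega
  simpa [Finset.union_eq_left.2 h] using key T

theorem IsMatroidRank.union_le (hv : IsMatroidRank v) (A S : Finset G) :
    v (A ∪ S) ≤ A.card + v S := by
  induction A using Finset.induction_on with
  | empty => simp
  | insert a A ha ih =>
    rw [Finset.insert_union, Finset.card_insert_of_notMem ha]
    rcases hv.insert_eq_or (A ∪ S) a with h | h <;> omega

theorem IsMatroidRank.le_card (hv : IsMatroidRank v) (S : Finset G) : v S ≤ S.card := by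
  simpa [hv.empty] using hv.union_le S ∅

/-- Subsets of independent sets are independent. -/
theorem IsMatroidRank.eq_card_of_subset (hv : IsMatroidRank v) {S T : Finset G} (h : S ⊆ T)
    (hT : v T = T.card) : v S = S.card := by
  have h1 := hv.union_le (T \ S) S
  rw [Finset.sdiff_union_of_subset h] at h1
  have h2 := hv.le_card S
  have h3 := Finset.card_sdiff_add_card_eq_card h
  omega

/-- Adding elements of the closure of a set does not change its rank. -/
theorem IsMatroidRank.union_eq (hv : IsMatroidRank v) {S : Finset G} (A : Finset G)
    (h : ∀ g ∈ A, v (insert g S) = v S) : v (A ∪ S) = v S := by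
  induction A using Finset.induction_on with
  | empty => simp
  | insert a A _ ih =>
    rw [Finset.insert_union, hv.insert_eq_of_subset Finset.subset_union_right
      (h a (Finset.mem_insert_self a A)), ih fun g hg => h g (Finset.mem_insert_of_mem hg)]

/-- A set that contains `S` and has the same rank has the same closure. -/
theorem IsMatroidRank.insert_eq_iff_of_subset (hv : IsMatroidRank v) {S T : Finset G}
    (h : S ⊆ T) (hST : v S = v T) (g : G) : v (insert g S) = v S ↔ v (insert g T) = v T := by
  refine ⟨hv.insert_eq_of_subset h, fun hg => ?_⟩
  have h1 := hv.mono (Finset.insert_subset_insert g h)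
  have h2 := hv.insert_eq_or S g
  omega

theorem IsMatroidRank.exists_independent_subset (hv : IsMatroidRank v) (S : Finset G) :
    ∃ I ⊆ S, v I = I.card ∧ v I = v S := by
  induction S using Finset.induction_on with
  | empty => exact ⟨∅, Finset.Subset.refl _, by simp [hv.empty], rfl⟩
  | insert a S ha ih =>
    obtain ⟨I, hIS, hI, hIv⟩ := ih
    rcases hv.insert_eq_or S a with h | h
    · exact ⟨I, hIS.trans (Finset.subset_insert a S), hI, by omega⟩
    · have h1 := hv.insert_eq_iff_of_subset hIS hIv a
      have h2 := hv.insert_eq_or I a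
      have haI : a ∉ I := fun h => ha (hIS h)
      refine ⟨insert a I, Finset.insert_subset_insert a hIS, ?_, by omega⟩
      rw [Finset.card_insert_of_notMem haI]
      omega

/-- If `z` is in the closure of `I` but not in that of `I - y`, and `w ∈ I` is such that `z` is in
the closure of `I - w`, then exchanging `y` for `z` does not change the closure of `I - w`. -/
theorem IsMatroidRank.insert_eq_iff_exchange_erase (hv : IsMatroidRank v) {I : Finset G}
    (hI : v I = I.card) {y z w : G} (hy : y ∈ I) (hw : w ∈ I) (hwy : w ≠ y) (hz : z ∉ I)
    (hzy : v (insert z (I.erase y)) = I.card) (hzw : v (insert z (I.erase w)) ≠ I.card) (g : G) :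
    v (insert g ((insert z (I.erase y)).erase w)) = I.card ↔
      v (insert g (I.erase w)) = I.card := by
  have hwz : w ≠ z := fun h => hz (h ▸ hw)
  have hset : (insert z (I.erase y)).erase w = insert z ((I.erase w).erase y) := by
    ext a; simp only [Finset.mem_erase, Finset.mem_insert]; grind
  have hpos : 0 < I.card := Finset.card_pos.2 ⟨w, hw⟩
  have h1 : v (I.erase w) = I.card - 1 := by
    rw [hv.eq_card_of_subset (Finset.erase_subset w I) hI, Finset.card_erase_of_mem hw]
  have hcI : (insert z (I.erase y)).card = I.card := by
    rw [Finset.card_insert_of_notMem (fun h => hz (Finset.mem_of_mem_erase h)),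
      Finset.card_erase_add_one hy]
  have h2 : v ((insert z (I.erase y)).erase w) = I.card - 1 := by
    rw [hv.eq_card_of_subset (Finset.erase_subset _ _) (hzy.trans hcI.symm),
      Finset.card_erase_of_mem (by simp [hwz, hwy, hw]), hcI]
  have h3 : v (insert z (I.erase w)) = I.card - 1 := by
    rcases hv.insert_eq_or (I.erase w) z with h | h <;> omega
  -- Both `I - w` and `(I - y + z) - w` lie in `I - w + z`, and all three have rank `|I| - 1`; hence
  -- their closures agree.
  have h4 := hv.insert_eq_iff_of_subset (S := (insert z (I.erase y)).erase w)
    (T := insert z (I.erase w)) (by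
      rw [hset]; exact Finset.insert_subset_insert z (Finset.erase_subset _ _)) (by omega) g
  have h5 := hv.insert_eq_iff_of_subset (S := I.erase w)
    (T := insert z (I.erase w)) (Finset.subset_insert _ _) (by omega) g
  have h6 := hv.insert_eq_or ((insert z (I.erase y)).erase w) g
  have h7 := hv.insert_eq_or (I.erase w) g
  omega

/-- Simultaneous exchange of the elements `y j` of an independent set for the elements `z j`, when
the exchange matrix is triangular with nonzero diagonal. -/
theorem IsMatroidRank.multi_exchange (hv : IsMatroidRank v) {ι : Type*} [LinearOrder ι]
    (J : Finset ι) (y z : ι → G) (I : Finset G) (hI : v I = I.card)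
    (hy : ∀ j ∈ J, y j ∈ I) (hz : ∀ j ∈ J, z j ∉ I)
    (hyinj : Set.InjOn y J) (hzinj : Set.InjOn z J)
    (hdiag : ∀ j ∈ J, v (insert (z j) (I.erase (y j))) = I.card)
    (htri : ∀ j ∈ J, ∀ m ∈ J, j < m → v (insert (z m) (I.erase (y j))) ≠ I.card) :
    v ((I \ J.image y) ∪ J.image z) = I.card ∧
      ((I \ J.image y) ∪ J.image z).card = I.card ∧
      ∀ g, v (insert g I) = I.card + 1 → (∀ j ∈ J, v (insert (z j) I) = I.card) →
        v (insert g ((I \ J.image y) ∪ J.image z)) = I.card + 1 := by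
  induction J using Finset.induction_on_max generalizing I with
  | empty => simp [hI]
  | insert a s hs ih =>
    have has : a ∉ s := fun h => lt_irrefl a (hs a h)
    have ha : a ∈ insert a s := Finset.mem_insert_self a s
    have hms : ∀ {j}, j ∈ s → j ∈ insert a s := fun h => Finset.mem_insert_of_mem h
    -- The exchange with the largest index goes first: by triangularity `z a` cannot replace any
    -- earlier `y j`, so the remaining exchange matrix is unchanged (`hiff`).
    set I' := insert (z a) (I.erase (y a)) with hI'
    have hcard : I'.card = I.card := by
      rw [hI', Finset.card_insert_of_notMem (fun h => hz a ha (Finset.mem_of_mem_erase h)),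
        Finset.card_erase_add_one (hy a ha)]
    have hyne : ∀ j ∈ s, y j ≠ y a := fun j hj h =>
      has (hyinj (hms hj) ha h ▸ hj)
    have hzne : ∀ j ∈ s, z j ≠ z a := fun j hj h =>
      has (hzinj (hms hj) ha h ▸ hj)
    have hiff : ∀ j ∈ s, ∀ g, v (insert g (I'.erase (y j))) = I.card ↔
        v (insert g (I.erase (y j))) = I.card := fun j hj g =>
      hv.insert_eq_iff_exchange_erase hI (hy a ha) (hy j (hms hj)) (hyne j hj) (hz a ha)
        (hdiag a ha) (htri j (hms hj) a ha (hs j hj)) g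
    have hset : (I' \ s.image y) ∪ s.image z =
        (I \ (insert a s).image y) ∪ (insert a s).image z := by
      have hza : ∀ j ∈ s, y j ≠ z a := fun j hj h => hz a ha (h ▸ hy j (hms hj))
      ext g
      simp only [hI', Finset.image_insert, Finset.mem_union, Finset.mem_sdiff, Finset.mem_insert,
        Finset.mem_erase, Finset.mem_image]
      grind
    obtain ⟨h1, h2, h3⟩ := ih I' (by rw [hcard]; exact hdiag a ha)
      (fun j hj => by simp [hI', hyne j hj, hy j (hms hj)])
      (fun j hj => by simp [hI', hzne j hj, hz j (hms hj)])
      (hyinj.mono fun j hj => hms hj) (hzinj.mono fun j hj => hms hj)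
      (fun j hj => by rw [hcard, hiff j hj]; exact hdiag j (hms hj))
      (fun j hj m hm hjm => by
        rw [hcard, Ne, hiff j hj]; exact htri j (hms hj) m (hms hm) hjm)
    rw [hset] at h1 h2 h3
    refine ⟨h1.trans hcard, h2.trans hcard, fun g hg hcl => ?_⟩
    have hza := hcl a ha
    -- As `z a` is in the closure of `I`, the sets `I'`, `I` and `I + z a` have the same rank and
    -- hence the same closure, so `g` stays outside it.
    have hsub : I' ⊆ insert (z a) I := Finset.insert_subset_insert _ (Finset.erase_subset _ _)
    have hrank : v I' = v (insert (z a) I) := by rw [hza]; exact hdiag a ha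
    have hcl' : ∀ g, v (insert g I') = I.card ↔ v (insert g I) = I.card := by
      intro g
      have e1 := hv.insert_eq_iff_of_subset hsub hrank g
      have e2 := hv.insert_eq_iff_of_subset (Finset.subset_insert (z a) I) (hI.trans hza.symm) g
      omega
    rw [← hcard]
    refine h3 g ?_ fun j hj => by rw [hcard, hcl']; exact hcl j (hms hj)
    have e1 := hv.insert_eq_or I' g
    have e2 := hcl' g
    omega

end MatroidRank

@[simp]
theorem mem_bundle {n : ℕ} {G : Type*} [Fintype G] {X : Allocation n G} {k : Option (Fin n)}
    {g : G} : g ∈ bundle X k ↔ X g = k := by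
  simp [bundle]

/-! ### Shortest paths and augmentation -/

section Paths

variable {n : ℕ} {G : Type*} [Fintype G] [DecidableEq G] {v : Fin n → Finset G → ℕ}
  {X : Allocation n G} {i : Fin n}

/-- An allocation is clean if every good in the bundle of an agent contributes to the value. -/
def Clean (v : Fin n → Finset G → ℕ) (X : Allocation n G) : Prop :=
  ∀ k, v k (bundle X (some k)) = (bundle X (some k)).card

theorem exchangeEdge_iff {k : Option (Fin n)} {g g' : G} (hg : X g = k) :
    ExchangeEdge v X g g' ↔
      extVal v k (insert g' ((bundle X k).erase g)) = extVal v k (bundle X k) := by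
  constructor
  · rintro ⟨l, hl, h⟩
    rw [mem_bundle, hg] at hl
    exact hl ▸ h
  · exact fun h => ⟨k, mem_bundle.2 hg, h⟩

theorem mem_desired {g : G} : g ∈ desired v X i ↔
    v i (insert g (bundle X (some i))) = v i (bundle X (some i)) + 1 := by
  rw [desired, Finset.mem_filter, marginal]
  simp only [Finset.mem_univ, true_and]
  omega

/-- The goods that end a walk with `s` edges in the exchange graph starting in `Fᵢ(X)`. -/
def level (v : Fin n → Finset G → ℕ) (X : Allocation n G) (i : Fin n) : ℕ → Set G
  | 0 => {g | g ∈ desired v X i}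
  | s + 1 => {g' | ∃ g ∈ level v X i s, ExchangeEdge v X g g'}

theorem level_add_of_walk {t : ℕ} {P : Fin (t + 1) → G}
    (hP : ∀ j : Fin t, ExchangeEdge v X (P j.castSucc) (P j.succ)) {s a : ℕ} (ha : a < t + 1)
    (h : P ⟨a, ha⟩ ∈ level v X i s) (m : ℕ) (hm : a + m < t + 1) :
    P ⟨a + m, hm⟩ ∈ level v X i (s + m) := by
  induction m with
  | zero => exact h
  | succ m ih => exact ⟨_, ih (by omega), hP ⟨a + m, by omega⟩⟩

theorem exists_walk_of_mem_level {s : ℕ} {g : G} (h : g ∈ level v X i s) :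
    ∃ Q : Fin (s + 1) → G, Q 0 ∈ desired v X i ∧ Q (Fin.last s) = g ∧
      ∀ j : Fin s, ExchangeEdge v X (Q j.castSucc) (Q j.succ) := by
  induction s generalizing g with
  | zero => exact ⟨fun _ => g, h, rfl, fun j => j.elim0⟩
  | succ s ih =>
    obtain ⟨g', hg', hE⟩ := h
    obtain ⟨Q, hQ0, hQl, hQ⟩ := ih hg'
    refine ⟨Fin.snoc Q g, ?_, by simp, fun j => ?_⟩
    · rw [← Fin.castSucc_zero, Fin.snoc_castSucc]; exact hQ0
    · refine Fin.lastCases ?_ (fun j => ?_) j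
      · rw [Fin.snoc_castSucc, Fin.succ_last, Fin.snoc_last, hQl]; exact hE
      · rw [Fin.snoc_castSucc, Fin.succ_castSucc, Fin.snoc_castSucc]; exact hQ j

theorem exists_transferPath_of_mem_level {s : ℕ} {g : G} (h : g ∈ level v X i s)
    (hg : X g = none) : ∃ Q : Fin (s + 1) → G, IsTransferPath v X i Q := by
  obtain ⟨Q, hQ0, hQl, hQ⟩ := exists_walk_of_mem_level h
  exact ⟨Q, hQ0, by simp [hQl, hg], hQ⟩

theorem exists_shortestTransferPath
    (h : ∃ (t : ℕ) (P : Fin (t + 1) → G), IsTransferPath v X i P) :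
    ∃ (t : ℕ) (P : Fin (t + 1) → G), IsShortestTransferPath v X i P := by
  classical
  obtain ⟨P, hP⟩ := Nat.find_spec h
  exact ⟨Nat.find h, P, hP, fun s Q hQ => Nat.find_min' h ⟨Q, hQ⟩⟩

variable {t : ℕ} {P : Fin (t + 1) → G}

theorem IsTransferPath.mem_level (hP : IsTransferPath v X i P) (a : Fin (t + 1)) :
    P a ∈ level v X i a := by
  have := level_add_of_walk (i := i) (s := 0) hP.2.2 (Nat.succ_pos t) hP.1 a (by omega)
  simpa using this

/-- A shorter walk to `P a`, continued along the rest of `P`, would reach `X₀` in fewer edges. All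
forms of "no shortcut" below come from this. -/
theorem IsShortestTransferPath.le_of_mem_level (hP : IsShortestTransferPath v X i P)
    {a : Fin (t + 1)} {s : ℕ} (h : P a ∈ level v X i s) : (a : ℕ) ≤ s := by
  have h1 := level_add_of_walk hP.1.2.2 a.2 h (t - a) (by omega)
  have h2 : (⟨a + (t - a), by omega⟩ : Fin (t + 1)) = Fin.last t := by
    ext; simp; omega
  rw [h2] at h1
  obtain ⟨Q, hQ⟩ := exists_transferPath_of_mem_level h1 (by simpa using hP.1.2.1)
  have := hP.2 _ Q hQ
  omega

theorem IsShortestTransferPath.injective (hP : IsShortestTransferPath v X i P) :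
    Function.Injective P := by
  intro a b hab
  have h1 := hP.le_of_mem_level (a := a) (s := b) (hab ▸ hP.1.mem_level b)
  have h2 := hP.le_of_mem_level (a := b) (s := a) (hab ▸ hP.1.mem_level a)
  exact Fin.ext (le_antisymm h1 h2)

theorem IsShortestTransferPath.ne_none (hP : IsShortestTransferPath v X i P) (j : Fin t) :
    X (P j.castSucc) ≠ none := by
  intro h
  obtain ⟨Q, hQ⟩ := exists_transferPath_of_mem_level (hP.1.mem_level j.castSucc) h
  have := hP.2 _ Q hQ
  simp at this
  omega

theorem IsShortestTransferPath.last_eq_none (hP : IsShortestTransferPath v X i P) :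
    X (P (Fin.last t)) = none := by
  simpa using hP.1.2.1

theorem IsShortestTransferPath.succ_notMem_desired (hP : IsShortestTransferPath v X i P)
    (j : Fin t) : P j.succ ∉ desired v X i := by
  intro h
  have := hP.le_of_mem_level (a := j.succ) (s := 0) h
  simp at this

/-- This supplies the triangularity required by `multi_exchange`. -/
theorem IsShortestTransferPath.not_exchangeEdge (hP : IsShortestTransferPath v X i P)
    {j m : Fin t} (hjm : j < m) : ¬ ExchangeEdge v X (P j.castSucc) (P m.succ) := by
  intro h
  have := hP.le_of_mem_level (a := m.succ) (s := j + 1) ⟨_, hP.1.mem_level j.castSucc, h⟩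
  simp at this
  omega

/-- The owner of a vertex of the path before the last one does not own the next vertex. -/
theorem IsShortestTransferPath.succ_ne (hX : Clean v X) (hv : ∀ k, IsMatroidRank (v k))
    (hP : IsShortestTransferPath v X i P) (j : Fin t) :
    X (P j.succ) ≠ X (P j.castSucc) := by
  intro h
  obtain ⟨k, hk⟩ := Option.ne_none_iff_exists'.1 (hP.ne_none j)
  have hE := (exchangeEdge_iff hk).1 (hP.1.2.2 j)
  have hne : P j.succ ≠ P j.castSucc := fun e =>
    absurd (hP.injective e) (Fin.castSucc_lt_succ (i := j)).ne'
  have hmem : P j.castSucc ∈ bundle X (some k) := mem_bundle.2 hk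
  -- The inserted good is already in the bundle, so the edge would say that a clean bundle keeps its
  -- value after losing a good.
  rw [Finset.insert_eq_of_mem (by simp [hne, h, hk])] at hE
  have h1 := (hv k).le_card ((bundle X (some k)).erase (P j.castSucc))
  have h2 := Finset.card_erase_lt_of_mem hmem
  have h3 := hX k
  simp only [extVal] at hE
  omega

/-- Consecutive path vertices have different owners, so nothing cancels in the symmetric difference:
each owner gives up its path goods and receives their successors. -/
theorem IsShortestTransferPath.augment_eq (hX : Clean v X) (hv : ∀ k, IsMatroidRank (v k))
    (hP : IsShortestTransferPath v X i P) (k : Option (Fin n)) :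
    augment X k P = (bundle X k \ Finset.univ.image P) ∪
      (Finset.univ.filter fun j : Fin t => X (P j.castSucc) = k).image (fun j => P j.succ) := by
  have hs := hP.succ_ne hX hv
  have hn := hP.ne_none
  have hl := hP.last_eq_none
  have hrange : ∀ g, (∃ a, P a = g) ↔ (P (Fin.last t) = g ∨ ∃ j : Fin t, P j.castSucc = g) := by
    intro g
    rw [Fin.exists_fin_succ', or_comm]
  ext g
  simp only [augment, Finset.mem_symmDiff, Finset.mem_erase, mem_bundle, Finset.mem_biUnion,
    Finset.mem_filter, Finset.mem_univ, true_and, Finset.mem_insert, Finset.mem_singleton,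
    Finset.mem_union, Finset.mem_sdiff, Finset.mem_image, hrange]
  constructor
  · rintro (⟨⟨h1, h2⟩, h3⟩ | ⟨⟨j, hj, rfl | rfl⟩, h⟩)
    · left
      refine ⟨h2, ?_⟩
      rintro (h | ⟨j, rfl⟩)
      · exact h1 h.symm
      · exact h3 ⟨j, h2, Or.inl rfl⟩
    · exfalso
      refine h ⟨fun e => hn j (e ▸ hl), hj⟩
    · exact Or.inr ⟨j, hj, rfl⟩
  · rintro (⟨h1, h2⟩ | ⟨j, hj, rfl⟩)
    · push Not at h2
      refine Or.inl ⟨⟨h2.1.symm, h1⟩, ?_⟩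
      rintro ⟨j, hj, rfl | rfl⟩
      · exact h2.2 j rfl
      · exact hs j (h1.trans hj.symm)
    · exact Or.inr ⟨⟨j, hj, Or.inr rfl⟩, fun h => hs j (h.2.trans hj.symm)⟩

theorem IsShortestTransferPath.exists_transfer (hX : Clean v X) (hv : ∀ k, IsMatroidRank (v k))
    (hP : IsShortestTransferPath v X i P) : ∃ Y, IsTransfer X i P Y := by
  classical
  have hinj := hP.injective
  -- The goods shift backwards along the path: `P 0` goes to `i`, and each later vertex to the owner
  -- of its predecessor.
  let Y : Allocation n G := fun g =>
    if h : ∃ a, P a = g then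
      Fin.cases (motive := fun _ => Option (Fin n)) (some i) (fun j => X (P j.castSucc)) h.choose
    else X g
  have hYP : ∀ a, Y (P a) =
      Fin.cases (motive := fun _ => Option (Fin n)) (some i) (fun j => X (P j.castSucc)) a := by
    intro a
    have h : ∃ b, P b = P a := ⟨a, rfl⟩
    have hc : h.choose = a := hinj h.choose_spec
    simp only [Y, dif_pos h, hc]
  have hY0 : Y (P 0) = some i := hYP 0
  have hYs : ∀ j : Fin t, Y (P j.succ) = X (P j.castSucc) := fun j => hYP j.succ
  have hYn : ∀ g, (¬ ∃ a, P a = g) → Y g = X g := fun g hg => dif_neg hg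
  have key : ∀ k g, Y g = k ↔ g ∈ augment X k P ∨ (k = some i ∧ g = P 0) := by
    intro k g
    rw [hP.augment_eq hX hv]
    simp only [Finset.mem_union, Finset.mem_sdiff, mem_bundle, Finset.mem_image, Finset.mem_filter,
      Finset.mem_univ, true_and]
    by_cases hg : ∃ a, P a = g
    · obtain ⟨a, rfl⟩ := hg
      refine Fin.cases ?_ (fun j => ?_) a
      · have : ∀ j : Fin t, P j.succ ≠ P 0 := fun j e => Fin.succ_ne_zero j (hinj e)
        rw [hY0]
        simp [this, eq_comm]
      · have : P j.succ ≠ P 0 := fun e => Fin.succ_ne_zero j (hinj e)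
        rw [hYs]
        simp [this, hinj.eq_iff]
    · have h1 : ∀ j : Fin t, P j.succ ≠ g := fun j e => hg ⟨_, e⟩
      have h2 : g ≠ P 0 := fun e => hg ⟨_, e.symm⟩
      rw [hYn g hg]
      simp [h1, h2, not_exists.1 hg]
  refine ⟨Y, ?_, fun k hk => ?_⟩
  · ext g
    rw [mem_bundle, key, Finset.mem_insert]
    simp [or_comm]
  · ext g
    rw [mem_bundle, key]
    simp [hk]

/-- The outcome of a transfer along a shortest path is clean, and only the utility of the agent
starting the path changes: it increases by one. -/
theorem IsTransfer.clean_and_utility {Y : Allocation n G} (hY : IsTransfer X i P Y)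
    (hX : Clean v X) (hv : ∀ k, IsMatroidRank (v k)) (hP : IsShortestTransferPath v X i P) :
    Clean v Y ∧ utility v Y = utility v X + Pi.single i 1 := by
  have hinj := hP.injective
  have key : ∀ k, v k (augment X (some k) P) = (bundle X (some k)).card ∧
      (augment X (some k) P).card = (bundle X (some k)).card ∧
      (k = i → v k (insert (P 0) (augment X (some k) P)) = (bundle X (some k)).card + 1) := by
    intro k
    set J := Finset.univ.filter fun j : Fin t => X (P j.castSucc) = some k with hJ
    have hmem : ∀ j ∈ J, X (P j.castSucc) = some k := fun j hj => by simpa [hJ] using hj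
    have hset : augment X (some k) P =
        (bundle X (some k) \ J.image fun j => P j.castSucc) ∪ J.image fun j => P j.succ := by
      rw [hP.augment_eq hX hv]
      congr 1
      ext g
      simp only [Finset.mem_sdiff, mem_bundle, Finset.mem_image, Finset.mem_univ, true_and, hJ,
        Finset.mem_filter]
      refine and_congr_right fun hg => not_congr ⟨?_, ?_⟩
      · rintro ⟨a, rfl⟩
        revert hg
        refine Fin.lastCases (fun hg => ?_) (fun j hg => ⟨j, hg, rfl⟩) a
        rw [hP.last_eq_none] at hg
        cases hg
      · rintro ⟨j, _, rfl⟩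
        exact ⟨_, rfl⟩
    have hedge : ∀ j ∈ J, ∀ g, ExchangeEdge v X (P j.castSucc) g ↔
        v k (insert g ((bundle X (some k)).erase (P j.castSucc))) = (bundle X (some k)).card := by
      intro j hj g
      rw [exchangeEdge_iff (hmem j hj), ← hX k]
      rfl
    obtain ⟨h1, h2, h3⟩ := (hv k).multi_exchange J (fun j => P j.castSucc) (fun j => P j.succ)
      (bundle X (some k)) (hX k) (fun j hj => mem_bundle.2 (hmem j hj))
      (fun j hj h => hP.succ_ne hX hv j ((mem_bundle.1 h).trans (hmem j hj).symm))
      (fun a _ b _ h => Fin.castSucc_injective t (hinj h))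
      (fun a _ b _ h => Fin.succ_injective t (hinj h))
      (fun j hj => (hedge j hj _).1 (hP.1.2.2 j))
      (fun j hj m _ hjm h => hP.not_exchangeEdge hjm ((hedge j hj _).2 h))
    rw [← hset] at h1 h2 h3
    refine ⟨h1, h2, ?_⟩
    rintro rfl
    -- For `i` itself, the received successors are outside `Fᵢ(X)`, hence in the closure of its
    -- bundle, and `P 0` is not; so `P 0` still adds one after the exchanges.
    refine h3 _ (hX k ▸ mem_desired.1 hP.1.1) fun j _ => ?_
    have e1 := hP.succ_notMem_desired j
    rw [mem_desired] at e1
    have e2 := (hv k).insert_eq_or (bundle X (some k)) (P j.succ)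
    have e3 := hX k
    omega
  have hi : v i (bundle Y (some i)) = (bundle X (some i)).card + 1 ∧
      (bundle Y (some i)).card = (bundle X (some i)).card + 1 := by
    obtain ⟨h1, h2, h3⟩ := key i
    rw [hY.1]
    have e1 := h3 rfl
    have e2 := (hv i).le_card (insert (P 0) (augment X (some i) P))
    have e3 := Finset.card_insert_le (P 0) (augment X (some i) P)
    omega
  constructor
  · intro k
    by_cases hk : k = i
    · subst hk; rw [hi.1, hi.2]
    · rw [hY.2 (some k) (by simpa using hk), (key k).1, (key k).2.1]
  · funext k
    by_cases hk : k = i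
    · subst hk
      simp [utility, hi.1, hX k]
    · have := hX k
      simp [utility, hk, hY.2 (some k) (by simpa using hk), (key k).1, this]

end Paths

/-! ### Tight sets of agents and the exchange property -/

section Exchange

/-- If `g` is in the closure of `I` and of all `I - a` with `a ∈ A`, then `g` is in the closure of
`I \ A`. -/
theorem IsMatroidRank.insert_sdiff_eq {G : Type*} [DecidableEq G] {v : Finset G → ℕ}
    (hv : IsMatroidRank v) {I A : Finset G} (hI : v I = I.card) (hA : A ⊆ I) {g : G}
    (hg : v (insert g I) = v I) (h : ∀ a ∈ A, v (insert g (I.erase a)) ≠ v I) :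
    v (insert g (I \ A)) = v (I \ A) := by
  induction A using Finset.induction_on with
  | empty => simpa using hg
  | insert a A ha ih =>
    have ih := ih ((Finset.subset_insert a A).trans hA)
      fun b hb => h b (Finset.mem_insert_of_mem hb)
    have haI : a ∈ I := hA (Finset.mem_insert_self a A)
    have hmem : a ∈ I \ A := Finset.mem_sdiff.2 ⟨haI, ha⟩
    have h0 := h a (Finset.mem_insert_self a A)
    have hset : I \ insert a A = (I \ A).erase a := by
      ext; simp only [Finset.mem_sdiff, Finset.mem_insert, Finset.mem_erase]; tauto
    rw [hset]
    rcases hv.insert_eq_or ((I \ A).erase a) g with h1 | h1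
    · exact h1
    exfalso
    have hcard := hv.eq_card_of_subset (Finset.sdiff_subset (s := I) (t := A)) hI
    have hcard' := hv.eq_card_of_subset
      ((Finset.erase_subset a _).trans (Finset.sdiff_subset (s := I) (t := A))) hI
    have hpos := Finset.card_erase_add_one hmem
    -- Otherwise `a` and `g` exchange: `a` is in the closure of `(I \ A) - a + g`, hence of `I - a +
    -- g`, which then has the rank of `I`, contrary to `h`.
    have h2 : v (insert a (insert g ((I \ A).erase a))) = v (insert g ((I \ A).erase a)) := by
      rw [Finset.insert_comm, Finset.insert_erase hmem]
      omega
    have h3 := hv.insert_eq_of_subset (T := insert g (I.erase a))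
      (Finset.insert_subset_insert g (Finset.erase_subset_erase a Finset.sdiff_subset)) h2
    rw [Finset.insert_comm, Finset.insert_erase haI, hg] at h3
    exact h0 h3.symm

variable {n : ℕ} {G : Type*} [Fintype G] [DecidableEq G]

theorem sum_card_bundle_inter (X : Allocation n G) (S : Finset (Fin n)) (R : Finset G) :
    ∑ k ∈ S, (bundle X (some k) ∩ R).card = (R.filter fun g => ∃ k ∈ S, X g = some k).card := by
  have h := Finset.sum_card_fiberwise_eq_card_filter R (S.map Function.Embedding.some) X
  rw [Finset.sum_map] at h
  convert h using 3 with k hk k hk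
  · ext g
    simp [and_comm]
  · simp [eq_comm]

variable {v : Fin n → Finset G → ℕ} {X : Allocation n G} {i : Fin n}

theorem sum_utility_le_card (hv : ∀ k, IsMatroidRank (v k)) (X : Allocation n G) :
    ∑ k, utility v X k ≤ Fintype.card G := by
  have h := sum_card_bundle_inter X Finset.univ Finset.univ
  have h1 : ∑ k, utility v X k ≤ ∑ k, (bundle X (some k) ∩ Finset.univ).card :=
    Finset.sum_le_sum fun k _ => by
      rw [Finset.inter_univ]
      exact (hv k).le_card _
  exact (h1.trans h.le).trans (Finset.card_le_univ _)

/-- A set of goods that contains `Fᵢ(X)`, that is closed in the exchange graph, and all of whose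
goods are allocated bounds the total utility of the agents owning these goods and `i`. -/
theorem sum_utility_le_of_closed (hv : ∀ k, IsMatroidRank (v k)) (hX : Clean v X) {R : Finset G}
    (hnone : ∀ g ∈ R, X g ≠ none) (hdesired : desired v X i ⊆ R)
    (hclosed : ∀ g ∈ R, ∀ g', ExchangeEdge v X g g' → g' ∈ R) {S : Finset (Fin n)}
    (hS : ∀ k, k ∈ S ↔ k = i ∨ ∃ g ∈ R, X g = some k) (Y : Allocation n G) :
    ∑ k ∈ S, utility v Y k ≤ ∑ k ∈ S, utility v X k := by
  -- Closedness of `R` puts every good outside `R` in the closure of `X_k \ R`. Thus outside `R` no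
  -- allocation gives `k` more than `X` does, while inside `R` the agents in `S` already own
  -- everything in `X`.
  have hcompl : ∀ k ∈ S, v k Rᶜ ≤ (bundle X (some k) \ R).card := by
    intro k hk
    have hspan : ∀ g ∈ Rᶜ, v k (insert g (bundle X (some k) \ R)) =
        v k (bundle X (some k) \ R) := by
      intro g hg
      have hg : g ∉ R := Finset.mem_compl.1 hg
      have hedge : ∀ a ∈ bundle X (some k) ∩ R,
          v k (insert g ((bundle X (some k)).erase a)) ≠ v k (bundle X (some k)) := by
        intro a ha h
        obtain ⟨ha, haR⟩ := Finset.mem_inter.1 ha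
        exact hg (hclosed a haR g ((exchangeEdge_iff (mem_bundle.1 ha)).2 h))
      have hgX : v k (insert g (bundle X (some k))) = v k (bundle X (some k)) := by
        rcases (hS k).1 hk with rfl | ⟨a, haR, ha⟩
        · have h1 : g ∉ desired v X k := fun h => hg (hdesired h)
          rw [mem_desired] at h1
          have h2 := (hv k).insert_eq_or (bundle X (some k)) g
          omega
        · have ha := mem_bundle.2 ha
          have h1 := hedge a (Finset.mem_inter.2 ⟨ha, haR⟩)
          have h2 := (hv k).insert_eq_or ((bundle X (some k)).erase a) g
          have h3 := (hv k).eq_card_of_subset (Finset.erase_subset a _) (hX k)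
          have h4 := Finset.card_erase_add_one ha
          have h5 := hX k
          exact (hv k).insert_eq_of_subset (Finset.erase_subset a _) (by omega)
      have h := (hv k).insert_sdiff_eq (hX k) Finset.inter_subset_left hgX hedge
      rwa [Finset.sdiff_inter_self_left] at h
    have h1 := (hv k).union_eq Rᶜ hspan
    have h2 := (hv k).mono (Finset.subset_union_left (s₁ := Rᶜ) (s₂ := bundle X (some k) \ R))
    have h3 := (hv k).le_card (bundle X (some k) \ R)
    omega
  have hY : ∑ k ∈ S, (bundle Y (some k) ∩ R).card ≤ R.card :=
    (sum_card_bundle_inter Y S R).le.trans (Finset.card_filter_le _ _)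
  have hR : ∑ k ∈ S, (bundle X (some k) ∩ R).card = R.card := by
    rw [sum_card_bundle_inter, Finset.filter_true_of_mem]
    intro g hg
    obtain ⟨k, hk⟩ := Option.ne_none_iff_exists'.1 (hnone g hg)
    exact ⟨k, (hS k).2 (Or.inr ⟨g, hg, hk⟩), hk⟩
  calc ∑ k ∈ S, utility v Y k
      ≤ ∑ k ∈ S, ((bundle Y (some k) ∩ R).card + (bundle X (some k) \ R).card) := by
        refine Finset.sum_le_sum fun k hk => ?_
        have h1 := (hv k).union_le (bundle Y (some k) ∩ R) Rᶜ
        have h2 : v k (bundle Y (some k)) ≤ v k (bundle Y (some k) ∩ R ∪ Rᶜ) :=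
          (hv k).mono fun g hg => by
            by_cases hgR : g ∈ R <;> simp [hgR, mem_bundle.1 hg]
        have h3 := hcompl k hk
        unfold utility
        omega
    _ ≤ ∑ k ∈ S, ((bundle X (some k) ∩ R).card + (bundle X (some k) \ R).card) := by
        rw [Finset.sum_add_distrib, Finset.sum_add_distrib, hR]
        exact Nat.add_le_add_right hY _
    _ = ∑ k ∈ S, utility v X k := by
        refine Finset.sum_congr rfl fun k _ => ?_
        rw [Finset.card_inter_add_card_sdiff]
        exact (hX k).symm

/-- If no unallocated good can be reached from `Fᵢ(X)`, then some set of agents containing `i`, the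
others owning goods that can be reached, has maximal total utility. -/
theorem exists_tight_of_noPath (hv : ∀ k, IsMatroidRank (v k)) (hX : Clean v X)
    (h : ¬ ∃ (t : ℕ) (P : Fin (t + 1) → G), IsTransferPath v X i P) :
    ∃ S : Finset (Fin n), i ∈ S ∧
      (∀ k ∈ S, k ≠ i → ∃ s, ∃ g ∈ level v X i s, X g = some k) ∧
      ∀ Y : Allocation n G, ∑ k ∈ S, utility v Y k ≤ ∑ k ∈ S, utility v X k := by
  classical
  set R : Finset G := Finset.univ.filter fun g => ∃ s, g ∈ level v X i s with hR
  have hmem : ∀ g, g ∈ R ↔ ∃ s, g ∈ level v X i s := fun g => by simp [hR]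
  refine ⟨Finset.univ.filter fun k => k = i ∨ ∃ g ∈ R, X g = some k, by simp, ?_, ?_⟩
  · intro k hk hki
    obtain ⟨g, hg, hgk⟩ := (Finset.mem_filter.1 hk).2.resolve_left hki
    obtain ⟨s, hs⟩ := (hmem g).1 hg
    exact ⟨s, g, hs, hgk⟩
  · refine sum_utility_le_of_closed (i := i) hv hX (R := R) ?_ ?_ ?_ (by simp)
    · intro g hg hn
      obtain ⟨s, hs⟩ := (hmem g).1 hg
      exact h ⟨s, exists_transferPath_of_mem_level hs hn⟩
    · exact fun g hg => (hmem g).2 ⟨0, hg⟩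
    · intro g hg g' hE
      obtain ⟨s, hs⟩ := (hmem g).1 hg
      exact (hmem g').2 ⟨s + 1, g, hs, hE⟩

/-- Every utility vector is that of a clean allocation. -/
theorem exists_clean (hv : ∀ k, IsMatroidRank (v k)) (X : Allocation n G) :
    ∃ Z, Clean v Z ∧ utility v Z = utility v X := by
  choose I hIs hIc hIv using fun k => (hv k).exists_independent_subset (bundle X (some k))
  let Z : Allocation n G := fun g => (X g).bind fun k => if g ∈ I k then some k else none
  have hZ : ∀ k, bundle Z (some k) = I k := by
    intro k
    ext g
    rw [mem_bundle]
    simp only [Z, Option.bind_eq_some_iff]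
    constructor
    · rintro ⟨l, _, hl⟩
      split_ifs at hl with h
      · exact Option.some.inj hl ▸ h
    · exact fun h => ⟨k, mem_bundle.1 (hIs k h), if_pos h⟩
  exact ⟨Z, fun k => by rw [hZ, hIc], funext fun k => by rw [utility, hZ, hIv]; rfl⟩

theorem bundle_update_none (X : Allocation n G) (g : G) (k : Fin n) :
    bundle (Function.update X g none) (some k) = (bundle X (some k)).erase g := by
  ext a
  by_cases h : a = g <;> simp [h]

theorem Clean.update_none (hv : ∀ k, IsMatroidRank (v k)) (hX : Clean v X) (g : G) :
    Clean v (Function.update X g none) := fun k => by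
  rw [bundle_update_none]
  exact (hv k).eq_card_of_subset (Finset.erase_subset _ _) (hX k)

theorem Clean.utility_update_none (hv : ∀ k, IsMatroidRank (v k)) (hX : Clean v X) {g : G}
    {j : Fin n} (hg : X g = some j) :
    utility v (Function.update X g none) + Pi.single j 1 = utility v X := by
  funext k
  have h := hX.update_none hv g k
  rw [bundle_update_none] at h
  simp only [Pi.add_apply, utility, bundle_update_none, h, hX k]
  by_cases hk : k = j
  · subst hk
    simpa using Finset.card_erase_add_one (mem_bundle.2 hg)
  · have : g ∉ bundle X (some k) := fun h => hk (by simpa [hg, eq_comm] using h)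
    simp [hk, Finset.erase_eq_of_notMem this]

theorem exists_increment (hv : ∀ k, IsMatroidRank (v k)) (hX : Clean v X)
    (h : ∃ (t : ℕ) (P : Fin (t + 1) → G), IsTransferPath v X i P) :
    ∃ Y, utility v Y = utility v X + Pi.single i 1 := by
  obtain ⟨t, P, hP⟩ := exists_shortestTransferPath h
  obtain ⟨Y, hY⟩ := hP.exists_transfer hX hv
  exact ⟨Y, (hY.clean_and_utility hX hv hP).2⟩

/-- The exchange property of the set of utility vectors. -/
theorem exists_exchange (hv : ∀ k, IsMatroidRank (v k)) (hX : Clean v X) {W : Allocation n G}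
    (hi : utility v X i < utility v W i) :
    (∃ Y, utility v Y = utility v X + Pi.single i 1) ∨
      ∃ j, j ≠ i ∧ utility v W j < utility v X j ∧
        ∃ (x : Fin n → ℕ) (Y : Allocation n G),
          x + Pi.single j 1 = utility v X ∧ utility v Y = x + Pi.single i 1 := by
  classical
  by_cases hpath : ∃ (t : ℕ) (P : Fin (t + 1) → G), IsTransferPath v X i P
  · exact Or.inl (exists_increment hv hX hpath)
  right
  obtain ⟨S, hiS, hS, hsum⟩ := exists_tight_of_noPath hv hX hpath
  obtain ⟨j, hjS, hj⟩ : ∃ j ∈ S, utility v W j < utility v X j := by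
    -- `S` is tight for `X` and `W` is better for `i ∈ S`, so `W` must be worse for another member
    -- of `S`.
    by_contra! hcon
    exact absurd (hsum W) (not_le.2 (Finset.sum_lt_sum hcon ⟨i, hiS, hi⟩))
  have hji : j ≠ i := fun h => by rw [h] at hj; omega
  refine ⟨j, hji, hj, ?_⟩
  have hex := hS j hjS hji
  -- Take a good of `j` at the least possible level. The walk to it meets no other good of `j`, so
  -- it survives when `g` is taken from `j`, and it then ends at an unallocated good.
  obtain ⟨g, hg, hgj⟩ := Nat.find_spec hex
  have hbundle : ∀ k, k ≠ j →
      bundle (Function.update X g none) (some k) = bundle X (some k) := by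
    intro k hk
    rw [bundle_update_none, Finset.erase_eq_of_notMem]
    exact fun h => hk (by simpa [hgj, eq_comm] using h)
  have hlevel : ∀ m ≤ Nat.find hex, level v X i m ⊆ level v (Function.update X g none) i m := by
    intro m
    induction m with
    | zero =>
      intro _ a ha
      have ha : a ∈ desired v X i := ha
      change a ∈ desired v _ i
      rw [mem_desired] at ha ⊢
      rwa [hbundle i hji.symm]
    | succ m ih =>
      rintro hm a ⟨b, hb, hE⟩
      refine ⟨b, ih (by omega) hb, ?_⟩
      obtain ⟨k, hk⟩ : ∃ k, X b = some k := Option.ne_none_iff_exists'.1 fun hn =>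
        hpath ⟨m, exists_transferPath_of_mem_level hb hn⟩
      have hkj : k ≠ j := by
        rintro rfl
        exact Nat.find_min hex (m := m) (by omega) ⟨b, hb, hk⟩
      have hbg : b ≠ g := by
        rintro rfl
        exact hkj (Option.some.inj (hk.symm.trans hgj))
      rw [exchangeEdge_iff hk] at hE
      rw [exchangeEdge_iff (k := some k) (by simp [hbg, hk]), hbundle k hkj]
      exact hE
  obtain ⟨Y, hY⟩ := exists_increment (i := i) hv (hX.update_none hv g)
    ⟨_, exists_transferPath_of_mem_level (hlevel _ le_rfl hg) (by simp)⟩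
  exact ⟨_, Y, hX.utility_update_none hv hgj, hY⟩

end Exchange

/-! ### Progress and termination -/

section Termination

variable {n : ℕ} {G : Type*} [Fintype G] [DecidableEq G] {v : Fin n → Finset G → ℕ}
  {β : Type*} [LinearOrder β] {φ : (Fin n → ℕ) → Fin n → β}

theorem clean_init (hv : ∀ k, IsMatroidRank (v k)) : Clean v (State.init n G).X := by
  intro k
  have : bundle (State.init n G).X (some k) = ∅ := by
    ext; simp [State.init]
  rw [this, (hv k).empty, Finset.card_empty]

theorem Step.clean (hv : ∀ k, IsMatroidRank (v k)) {s s' : State n G} (h : Step v φ s s')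
    (hs : Clean v s.X) : Clean v s'.X := by
  cases h with
  | transfer X Y U i t P chosen shortest result => exact (result.clean_and_utility hs hv shortest).1
  | remove => exact hs

theorem Reachable.clean (hv : ∀ k, IsMatroidRank (v k)) {s : State n G}
    (h : Reachable v φ s) : Clean v s.X := by
  induction h with
  | refl => exact clean_init hv
  | tail _ hstep ih => exact hstep.clean hv ih

theorem exists_isChosen (x : Fin n → ℕ) {U : Finset (Fin n)} (hU : U ≠ ∅) :
    ∃ i, IsChosen φ x U i := by
  obtain ⟨m, hm, hmax⟩ := Finset.exists_max_image U (φ x) (Finset.nonempty_iff_ne_empty.2 hU)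
  obtain ⟨i, hi, hmin⟩ := Finset.exists_min_image (U.filter fun j => ∀ k ∈ U, φ x k ≤ φ x j) id
    ⟨m, Finset.mem_filter.2 ⟨hm, hmax⟩⟩
  exact ⟨i, Finset.mem_filter.1 hi, fun j hj => hmin j (Finset.mem_filter.2 hj)⟩

theorem exists_step (hv : ∀ k, IsMatroidRank (v k)) {s : State n G} (hs : Clean v s.X)
    (hU : s.U ≠ ∅) : ∃ s', Step v φ s s' := by
  obtain ⟨i, hi⟩ := exists_isChosen (φ := φ) (utility v s.X) hU
  by_cases hpath : ∃ (t : ℕ) (P : Fin (t + 1) → G), IsTransferPath v s.X i P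
  · obtain ⟨t, P, hP⟩ := exists_shortestTransferPath hpath
    obtain ⟨Y, hY⟩ := hP.exists_transfer hs hv
    exact ⟨_, Step.transfer s.X Y s.U i t P hi hP hY⟩
  · exact ⟨_, Step.remove s.X s.U i hi hpath⟩

/-- The number of iterations left in the worst case. -/
def potential (v : Fin n → Finset G → ℕ) (s : State n G) : ℕ :=
  (Fintype.card G - ∑ k, utility v s.X k) + s.U.card

theorem Step.potential_lt (hv : ∀ k, IsMatroidRank (v k)) {s s' : State n G}
    (h : Step v φ s s') (hs : Clean v s.X) : potential v s' < potential v s := by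
  cases h with
  | transfer X Y U i t P chosen shortest result =>
    have h1 := (result.clean_and_utility hs hv shortest).2
    -- This bound is what makes the truncated subtraction in the potential really drop.
    have h2 := sum_utility_le_card hv Y
    have h3 : ∑ k, utility v Y k = ∑ k, utility v X k + 1 := by
      rw [h1]
      simp [Finset.sum_add_distrib]
    unfold potential
    dsimp only
    omega
  | remove X U i chosen noPath =>
    have := Finset.card_erase_lt_of_mem chosen.1.1
    unfold potential
    dsimp only
    omega

theorem terminates (hv : ∀ k, IsMatroidRank (v k)) : Terminates (G := G) v φ := by
  refine ⟨fun s hs hU => exists_step hv (hs.clean hv) hU, ?_⟩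
  rintro ⟨r, h0, hr⟩
  have hreach : ∀ k, Reachable v φ (r k) := by
    intro k
    induction k with
    | zero => rw [h0]; exact Relation.ReflTransGen.refl
    | succ k ih => exact Relation.ReflTransGen.tail ih (hr k)
  have hpot : ∀ k, potential v (r k) + k ≤ potential v (r 0) := by
    intro k
    induction k with
    | zero => simp
    | succ k ih =>
      have := (hr k).potential_lt hv ((hreach k).clean hv)
      omega
  have := hpot (potential v (r 0) + 1)
  omega

end Termination

/-! ### Comparison with the lexicographically largest maximizing allocation -/

section Optimality

variable {n b : ℕ} {G : Type*} [Fintype G] {v : Fin n → Finset G → ℕ}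
  {Ψ : JusticeCriterion n} {φ : (Fin n → ℕ) → Fin n → Lex (Fin b → ℝ)}

theorem IsMaximizing.ge {Z : Allocation n G} (hZ : IsMaximizing Ψ v Z) (Y : Allocation n G) :
    Ψ.ge (utility v Z) (utility v Y) := by
  by_contra h
  exact hZ ⟨Y, (Ψ.total _ _).resolve_left h, h⟩

theorem exists_isMaximizing (Ψ : JusticeCriterion n) (v : Fin n → Finset G → ℕ) :
    ∃ Z : Allocation n G, IsMaximizing Ψ v Z := by
  classical
  let r : Allocation n G → Allocation n G → Prop := fun Y Z => Ψ.gt (utility v Y) (utility v Z)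
  have : IsTrans (Allocation n G) r := ⟨fun _ _ _ h1 h2 =>
    ⟨Ψ.trans _ _ _ h1.1 h2.1, fun h => h1.2 (Ψ.trans _ _ _ h2.1 h)⟩⟩
  have : Std.Irrefl r := ⟨fun _ h => h.2 h.1⟩
  obtain ⟨Z, _, hZ⟩ := (Finite.wellFounded_of_trans_of_irrefl r).has_min Set.univ
    ⟨fun _ => none, trivial⟩
  exact ⟨Z, fun ⟨Y, hY⟩ => hZ Y trivial hY⟩

theorem exists_lexMax_isMaximizing (Ψ : JusticeCriterion n) (v : Fin n → Finset G → ℕ) :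
    ∃ Z : Allocation n G, IsMaximizing Ψ v Z ∧ ∀ Y : Allocation n G, IsMaximizing Ψ v Y →
      toLex (utility v Y) ≤ toLex (utility v Z) := by
  classical
  obtain ⟨Z₀, hZ₀⟩ := exists_isMaximizing Ψ v
  obtain ⟨Z, hZ, hmax⟩ := Finset.exists_max_image
    (Finset.univ.filter fun Z : Allocation n G => IsMaximizing Ψ v Z)
    (fun Z => toLex (utility v Z)) ⟨Z₀, by simp [hZ₀]⟩
  exact ⟨Z, (Finset.mem_filter.1 hZ).2, fun Y hY => hmax Y (by simp [hY])⟩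

/-- Such a `Y` would Pareto-dominate `Z`, hence be strictly better. -/
theorem IsMaximizing.utility_ne_add_single (hC1 : ParetoDominance Ψ) {Z : Allocation n G}
    (hZ : IsMaximizing Ψ v Z) (Y : Allocation n G) (i : Fin n) :
    utility v Y ≠ utility v Z + Pi.single i 1 := by
  intro h
  obtain ⟨h1, h2⟩ := hC1 (utility v Z + Pi.single i 1) (utility v Z) fun k => by simp
  have h3 := h2.1 ⟨h1, h ▸ hZ.ge Y⟩
  simpa using congrFun h3 i

variable [DecidableEq G]

/-- The utility vectors of the states of a run stay below the lexicographically largest utility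
vector of a maximizing allocation, and agree with it at the agents that no longer play. -/
theorem Reachable.utility_le (hv : ∀ k, IsMatroidRank (v k)) (hC1 : ParetoDominance Ψ)
    (hC2 : IsGainFunction Ψ φ) {Z : Allocation n G} (hZ : IsMaximizing Ψ v Z)
    (hlex : ∀ Y : Allocation n G, IsMaximizing Ψ v Y →
      toLex (utility v Y) ≤ toLex (utility v Z))
    {s : State n G} (h : Reachable v φ s) :
    (∀ k, utility v s.X k ≤ utility v Z k) ∧
      ∀ k, k ∉ s.U → utility v s.X k = utility v Z k := by
  induction h with
  | refl =>
    refine ⟨fun k => ?_, fun k hk => absurd (Finset.mem_univ k) hk⟩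
    have h1 := clean_init (G := G) hv k
    have h2 : bundle (State.init n G).X (some k) = ∅ := by
      ext; simp [State.init]
    rw [utility, h1, h2]
    exact Nat.zero_le _
  | tail hreach hstep ih =>
    have hclean := Reachable.clean hv hreach
    cases hstep with
    | remove X U i chosen noPath =>
      obtain ⟨hle, heq⟩ := ih
      refine ⟨hle, fun k hk => ?_⟩
      by_cases hkU : k ∈ U
      · have hki : k = i := by
          by_contra hne
          exact hk (Finset.mem_erase.2 ⟨hne, hkU⟩)
        -- On the tight set, `X` is coordinatewise below `Z` but its total is no smaller, so the two
        -- agree there, in particular at `i`.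
        obtain ⟨S, hiS, -, hsum⟩ := exists_tight_of_noPath hv hclean noPath
        have := (Finset.sum_eq_sum_iff_of_le fun k _ => hle k).1
          (le_antisymm (Finset.sum_le_sum fun k _ => hle k) (hsum Z))
        exact this k (hki ▸ hiS)
      · exact heq k hkU
    | transfer X Y U i t P chosen shortest result =>
      obtain ⟨hle, heq⟩ := ih
      dsimp only at hle heq hclean ⊢
      have hY := (result.clean_and_utility hclean hv shortest).2
      suffices hlt : utility v X i < utility v Z i by
        constructor
        · intro k
          by_cases hk : k = i
          · subst hk; simpa [hY] using hlt
          · simpa [hY, hk] using hle k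
        · intro k hk
          have hki : k ≠ i := fun h => hk (h ▸ chosen.1.1)
          simpa [hY, hki] using heq k hk
      by_contra hcon
      have hxi : utility v X i = utility v Z i := le_antisymm (hle i) (not_lt.1 hcon)
      obtain ⟨Z', hZ'c, hZ'u⟩ := exists_clean hv Z
      -- `Y` gives `i` one more than `Z` does. In the second case `y` is the vector of `Z` minus
      -- `e_j`, and `W` realizes `y + e_i`.
      rcases exists_exchange (i := i) (W := Y) hv hZ'c (by simp [hZ'u, hY, hxi]) with
        ⟨W, hW⟩ | ⟨j, hji, hj, y, W, hyj, hyi⟩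
      · exact hZ.utility_ne_add_single hC1 W i (hZ'u ▸ hW)
      rw [hZ'u] at hj hyj
      have hj' : utility v X j < utility v Z j := by simpa [hY, hji] using hj
      have hjU : j ∈ U := by
        by_contra h
        exact absurd (heq j h) hj'.ne
      have hyj' : y j + 1 = utility v Z j := by simpa using congrFun hyj j
      have hyi' : y i = utility v Z i := by simpa [hji.symm] using congrFun hyj i
      -- By (G2) the gain depends only on the agent's own coordinate, and antitonically: `y` agrees
      -- with the vector of `X` at `i` and is at least as large at `j`.
      have e1 : φ y i = φ (utility v X) i :=
        ((hC2.G2 y (utility v X) i (by omega)).2 (by omega))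
      have e2 : φ y j ≤ φ (utility v X) j := (hC2.G2 (utility v X) y j (by omega)).1
      have e3 : φ (utility v X) j ≤ φ (utility v X) i := chosen.1.2 j hjU
      obtain ⟨g1, g2⟩ := hC2.G1 y i j (e1 ▸ e2.trans e3)
      rw [hyj, ← hyi] at g1 g2
      -- `W` is at least as good as the maximizing `Z`, so they are equally good and all the gain
      -- inequalities above are equalities; `j` was thus a candidate too, and the least-index rule
      -- gives `i < j`.
      have hφ := g2.1 ⟨g1, hZ.ge W⟩
      have hWmax : IsMaximizing Ψ v W := fun ⟨T, hT⟩ =>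
        hZ ⟨T, Ψ.trans _ _ _ hT.1 g1, fun h => hT.2 (Ψ.trans _ _ _ g1 h)⟩
      have hφX : φ (utility v X) j = φ (utility v X) i :=
        le_antisymm e3 (by rw [← e1, hφ]; exact e2)
      have hij : i < j := lt_of_le_of_ne
        (chosen.2 j ⟨hjU, fun k hk => hφX ▸ chosen.1.2 k hk⟩) hji.symm
      refine absurd (hlex W hWmax) (not_le.2 ?_)
      refine (lexDominates_iff (utility v W) (utility v Z)).1 ?_
      refine ⟨i, fun k hk => ?_, ?_⟩
      · rw [hyi, ← hyj]
        simp [hk.ne, (hk.trans hij).ne]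
      · rw [hyi, ← hyi']
        simp

end Optimality

end YankeeSwap

theorem mainTheorem1 {n b : ℕ} {G : Type*} [Fintype G] [DecidableEq G]
    (v : Fin n → Finset G → ℕ) (hv : ∀ i, YankeeSwap.IsMatroidRank (v i))
    (Ψ : YankeeSwap.JusticeCriterion n) (φ : (Fin n → ℕ) → Fin n → Lex (Fin b → ℝ))
    (hC1 : YankeeSwap.ParetoDominance Ψ) (hC2 : YankeeSwap.IsGainFunction Ψ φ) :
    YankeeSwap.Terminates v φ ∧
      ∀ X : YankeeSwap.Allocation n G, YankeeSwap.IsOutput v φ X →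
        YankeeSwap.IsMaximizing Ψ v X ∧
          ∀ Y : YankeeSwap.Allocation n G, YankeeSwap.IsMaximizing Ψ v Y →
            YankeeSwap.utility v Y ≠ YankeeSwap.utility v X →
              YankeeSwap.LexDominates (YankeeSwap.utility v X) (YankeeSwap.utility v Y) := by
  refine ⟨YankeeSwap.terminates hv, fun X hX => ?_⟩
  obtain ⟨Z, hZ, hlex⟩ := YankeeSwap.exists_lexMax_isMaximizing Ψ v
  have hXZ : YankeeSwap.utility v X = YankeeSwap.utility v Z :=
    funext fun k => (YankeeSwap.Reachable.utility_le hv hC1 hC2 hZ hlex hX).2 k (by simp)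
  unfold YankeeSwap.IsMaximizing
  rw [hXZ]
  refine ⟨hZ, fun Y hY hne => (YankeeSwap.lexDominates_iff _ _).2 (lt_of_le_of_ne (hlex Y hY) ?_)⟩
  exact fun h => hne (toLex_inj.1 h)
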